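/- Let $\mathbb E$ be a finite-dimensional real space with Euclidean norm $\|x\|=\langle Bx,x\rangle^{1/2}$, $B\succ0$, and dual norm $\|\cdot\|_*$ on $\mathbb E^*$. Let $f:\mathbb E\to\mathbb R$ be convex and three times differentiable with $\|D^3f(u)-D^3f(v)\|\le H_f\|u-v\|^\nu$ for all $u,v\in\mathbb E$, where $\nu\in[0,1]$ and $H_f>0$. Let $\varphi:\mathbb E\to\mathbb R\cup\{+\infty\}$ be a closed convex function whose effective domain has nonempty relative interior. Suppose that $\tilde f=f+\varphi$ has a global minimizer $x^*$, that $\tilde f(x)\le\tilde f(x_0)$, and that $\|z-x^*\|\le R_0$ whenever $\tilde f(z)\le\tilde f(x_0)$, where $1\le R_0<\infty$. Let $H\ge 2H_f$ and put $$\Omega(y)=f(x)+\sum_{i=1}^3\tfrac1{i!}D^if(x)[y-x]^i+\tfrac H6\|y-x\|^{3+\nu},\qquad \rho(y)=\tfrac12\langle\nabla^2f(x)(y-x),y-x\rangle+\tfrac1{3+\nu}\|y-x\|^{3+\nu},$$ $$\beta_\rho(u,v)=\rho(v)-\rho(u)-\langle\nabla\rho(u),v-u\rangle,\qquad \tau=\Big[\tfrac{(3+\nu)H}{6H_f}\Big]^{\frac1{1+\nu}},$$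 $$L_H=\max\Big\{\tfrac{\tau+1}{\tau},\ \tau^\nu(\tau+1)H_f\Big\},\quad \mu_H=\min\Big\{\tfrac{\tau-1}{\tau},\ \tau^\nu(\tau-1)H_f\Big\},\quad N_x=\|\nabla^2f(x)\|+12R_0^2 .$$ Let $(y_k)_{k\ge0}$ be generated by the Bregman proximal gradient method for $\Omega+\varphi$: $y_0=x$ and $$y_{k+1}\in\arg\min_{z\in\mathbb E}\big\{\langle\nabla\Omega(y_k),z-y_k\rangle+2L_H\beta_\rho(y_k,z)+\varphi(z)\big\},\qquad k\ge0.$$ Then, for all $k\ge1$, $$g_\varphi(y_k):=2L_H\big[\nabla\rho(y_{k-1})-\nabla\rho(y_k)\big]-\nabla\Omega(y_{k-1})\in\partial\varphi(y_k).$$ Moreover, assume that it is not the case that $\nu=0$ and $H=2H_f$ (so that $\mu_H>0$), and let $$K_{x,H}=\log_2\left(\frac{4(3+\nu)(2L_H)^{2+\nu}N_x^3\mu_H}{2^{-(1+\nu)}}\right).$$ If $\epsilon\in(0,1)$, $T\ge0$ is an integer and $\|\nabla\Omega(y_{T+1})+g_\varphi(y_{T+1})\|_*>\epsilon$, then $$T\le\Big[\log_2\Big(\tfrac{2L_H}{2L_H-\mu_H}\Big)\Big]^{-1}\max\big\{1,\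 K_{x,H}+(3+\nu)\log_2(\epsilon^{-1})\big\};$$ in particular, if also $\epsilon\le\frac12$ and $K_{x,H}\ge0$, then $$T\le\Big[\log_2\Big(\tfrac{2L_H}{2L_H-\mu_H}\Big)\Big]^{-1}\big[K_{x,H}+(3+\nu)\big]\log_2(\epsilon^{-1}).$$ -/

import Mathlib

noncomputable section

namespace BregmanTensor

/-- Every finite-dimensional real space with the Euclidean norm `⟨B x, x⟩ ^ (1/2)` of a positive
definite `B` is a finite-dimensional real inner product space. Gradients live in the dual space
`E →L[ℝ] ℝ`, whose operator norm is the conjugate norm `‖·‖_*`; the gradient of `g` at `y` is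
`fderiv ℝ g y`. -/
def ThriceDifferentiable {E : Type*} [NormedAddCommGroup E] [InnerProductSpace ℝ E]
    (f : E → ℝ) : Prop :=
  ∀ i < 3, Differentiable ℝ (iteratedFDeriv ℝ i f)

/-- `D³f` is Hölder continuous with exponent `ν` and constant `Hf`. -/
def HolderThirdDeriv {E : Type*} [NormedAddCommGroup E] [InnerProductSpace ℝ E]
    (f : E → ℝ) (ν Hf : ℝ) : Prop :=
  ∀ u v : E, ‖iteratedFDeriv ℝ 3 f u - iteratedFDeriv ℝ 3 f v‖ ≤ Hf * ‖u - v‖ ^ ν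

/-- Third-order Taylor polynomial `Φ_{x,3}(y)` of `f` at `x`. -/
def taylor3 {E : Type*} [NormedAddCommGroup E] [InnerProductSpace ℝ E]
    (f : E → ℝ) (x y : E) : ℝ :=
  f x + ∑ i ∈ Finset.Icc 1 3, (1 / (Nat.factorial i : ℝ)) * iteratedFDeriv ℝ i f x (fun _ => y - x)

/-- The regularized model `Ω(y) = Φ_{x,3}(y) + (H / 6) ‖y - x‖ ^ (3 + ν)`. -/
def omega {E : Type*} [NormedAddCommGroup E] [InnerProductSpace ℝ E]
    (f : E → ℝ) (ν H : ℝ) (x y : E) : ℝ :=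
  taylor3 f x y + H / 6 * ‖y - x‖ ^ (3 + ν)

/-- The scaling function `ρ_x(y) = ½ ⟨∇²f(x)(y - x), y - x⟩ + ‖y - x‖ ^ (3 + ν) / (3 + ν)`. -/
def rho {E : Type*} [NormedAddCommGroup E] [InnerProductSpace ℝ E]
    (f : E → ℝ) (ν : ℝ) (x y : E) : ℝ :=
  1 / 2 * iteratedFDeriv ℝ 2 f x (fun _ => y - x) + 1 / (3 + ν) * ‖y - x‖ ^ (3 + ν)

/-- Bregman distance `β_d(u, v) = d(v) - d(u) - ⟨∇d(u), v - u⟩`. -/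
def bregman {E : Type*} [NormedAddCommGroup E] [InnerProductSpace ℝ E]
    (d : E → ℝ) (u v : E) : ℝ :=
  d v - d u - fderiv ℝ d u (v - u)

def tauH (ν Hf H : ℝ) : ℝ := ((3 + ν) * H / (6 * Hf)) ^ (1 / (1 + ν))

/-- Relative smoothness constant `L_H`. -/
def LH (ν Hf H : ℝ) : ℝ :=
  max ((tauH ν Hf H + 1) / tauH ν Hf H) (tauH ν Hf H ^ ν * (tauH ν Hf H + 1) * Hf)

/-- Relative strong convexity constant `μ_H`. -/
def muH (ν Hf H : ℝ) : ℝ :=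
  min ((tauH ν Hf H - 1) / tauH ν Hf H) (tauH ν Hf H ^ ν * (tauH ν Hf H - 1) * Hf)

/-- `N_x = ‖∇²f(x)‖ + 12 R₀²`. -/
def Nx {E : Type*} [NormedAddCommGroup E] [InnerProductSpace ℝ E]
    (f : E → ℝ) (x : E) (R₀ : ℝ) : ℝ :=
  ‖iteratedFDeriv ℝ 2 f x‖ + 12 * R₀ ^ 2

/-- `K_{x,H} = log₂ (4 (3 + ν) (2 L_H)^(2 + ν) N_x³ μ_H / 2^(-(1 + ν)))`. -/
def KxH {E : Type*} [NormedAddCommGroup E] [InnerProductSpace ℝ E]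
    (f : E → ℝ) (ν Hf H : ℝ) (x : E) (R₀ : ℝ) : ℝ :=
  Real.logb 2 (4 * (3 + ν) * (2 * LH ν Hf H) ^ (2 + ν) * Nx f x R₀ ^ 3 * muH ν Hf H /
    2 ^ (-(1 + ν)))

/-- Closed convex function `φ : E → ℝ ∪ {+∞}`: never `-∞`, with closed convex epigraph. -/
structure IsClosedConvex {E : Type*} [NormedAddCommGroup E] [InnerProductSpace ℝ E]
    (φ : E → EReal) : Prop where
  ne_bot : ∀ z, φ z ≠ ⊥
  convex_epi : Convex ℝ {p : E × ℝ | φ p.1 ≤ (p.2 : EReal)}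
  closed_epi : IsClosed {p : E × ℝ | φ p.1 ≤ (p.2 : EReal)}

/-- Effective domain. -/
def effDom {E : Type*} (φ : E → EReal) : Set E := {z | φ z ≠ ⊤}

/-- The subdifferential `∂φ(y)`, a subset of the dual space (empty outside the domain of `φ`). -/
def subdiff {E : Type*} [NormedAddCommGroup E] [InnerProductSpace ℝ E]
    (φ : E → EReal) (y : E) : Set (E →L[ℝ] ℝ) :=
  {s | y ∈ effDom φ ∧ ∀ z, φ y + ((s (z - y) : ℝ) : EReal) ≤ φ z}

/-- The composite objective `f + φ`. -/
def composite {E : Type*} (f : E → ℝ) (φ : E → EReal) (z : E) : EReal := (f z : EReal) + φ z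

/-- `y` is a sequence generated by the Bregman proximal gradient method for `Ω + φ` with scaling
function `ρ_x`: `y₀ = x` and
`y_{k+1} ∈ argmin_z {⟨∇Ω(y_k), z - y_k⟩ + 2 L_H β_{ρ_x}(y_k, z) + φ(z)}`. -/
structure IsBregmanProxSeq {E : Type*} [NormedAddCommGroup E] [InnerProductSpace ℝ E]
    (f : E → ℝ) (φ : E → EReal) (ν Hf H : ℝ) (x : E) (y : ℕ → E) : Prop where
  init : y 0 = x
  step : ∀ k, IsMinOn
    (fun z => ((fderiv ℝ (omega f ν H x) (y k) (z - y k)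
      + 2 * LH ν Hf H * bregman (rho f ν x) (y k) z : ℝ) : EReal) + φ z) Set.univ (y (k + 1))

/-- The explicit subgradient
`g_φ(y_k) = 2 L_H [∇ρ_x(y_{k-1}) - ∇ρ_x(y_k)] - ∇Ω(y_{k-1})`, meant for `k ≥ 1`. -/
def gPhi {E : Type*} [NormedAddCommGroup E] [InnerProductSpace ℝ E]
    (f : E → ℝ) (ν Hf H : ℝ) (x : E) (y : ℕ → E) (k : ℕ) : E →L[ℝ] ℝ :=
  (2 * LH ν Hf H) • (fderiv ℝ (rho f ν x) (y (k - 1)) - fderiv ℝ (rho f ν x) (y k))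
    - fderiv ℝ (omega f ν H x) (y (k - 1))

end BregmanTensor

end

open BregmanTensor

noncomputable section

namespace BregmanTensor

/-! ### Second-order conditions along segments -/

section SecondOrder

variable {E : Type*} [NormedAddCommGroup E] [NormedSpace ℝ E]

/-! Everything rests on the Hessian sandwich `μ_H ∇²ρ ≤ ∇²Ω ≤ L_H ∇²ρ` (`omegaHess_bounds`).
Convexity of `f` at the points `x ± τh` and the Hölder condition bound `|D³f(x)[h]|` by `∇²f(x)/τ`
plus a multiple of `‖h‖^(1+ν)`. The number `τ` is the one for which the regularizer of `Ω` carries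
the coefficient `τ^(1+ν) H_f`. Hence `Ω` is smooth and strongly convex relative to `ρ`.

The inclusion of `g_φ` in the subdifferential is the first-order optimality condition of the
proximal step.

Write `F = Ω + φ`, `L = L_H`, `μ = μ_H`, `N = N_x`, `r = 2L/(2L - μ)`, `D = F(y_T) - F(y_{T+1})`.
Two estimates meet in `D`. Upper bound: the three-point inequality `modelValue_sub_le` is used with
comparison point `y_{T+1}`, so that no minimizer of `F` is needed. Since `F(y_k)` decreases, each of
the first `T` steps has gap at least `D`, and the contraction gives `(r^T - 1) D ≤ μ ρ(y_{T+1}) ≤ 3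
μ N²`. Lower bound: `∇Ω(y_{T+1}) + g_φ(y_{T+1})` is, up to sign, the increment of the gradient of
the convex function `2Lρ - Ω` over the last step. Cocoercivity bounds its squared norm by `4 L N D`
(`sq_norm_gradient_le`). Both need the iterates within `2R₀` of `x`; this holds because `f ≤ Ω` with
equality at `x`, so decrease of `F` keeps them in the initial sublevel set of `f + φ`. Taking
logarithms finishes the proof. -/

theorem hasDerivAt_comp_line {F : Type*} [NormedAddCommGroup F] [NormedSpace ℝ F]
    {g : E → F} {g' : E → E →L[ℝ] F} (hg : ∀ y, HasFDerivAt g (g' y) y) (u w : E) (t : ℝ) :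
    HasDerivAt (fun s : ℝ => g (u + s • w)) (g' (u + t • w) w) t := by
  have h1 : HasDerivAt (fun s : ℝ => u + s • w) w t := by
    simpa using ((hasDerivAt_id t).smul_const w).const_add u
  exact (hg _).comp_hasDerivAt t h1

theorem hasDerivAt_comp_line_apply {g : E → E →L[ℝ] ℝ} {g' : E → E →L[ℝ] E →L[ℝ] ℝ}
    (hg : ∀ y, HasFDerivAt g (g' y) y) (u w z : E) (t : ℝ) :
    HasDerivAt (fun s : ℝ => g (u + s • w) z) (g' (u + t • w) w z) t := by
  simpa using (hasDerivAt_comp_line hg u w t).clm_apply (hasDerivAt_const t z)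

/-- Mean value inequality on `[0, 1]`. -/
theorem sub_le_of_deriv_le {g g' : ℝ → ℝ} (hg : ∀ t, HasDerivAt g (g' t) t) {M : ℝ}
    (hM : ∀ t ∈ Set.Ioo (0 : ℝ) 1, g' t ≤ M) : g 1 - g 0 ≤ M := by
  obtain ⟨c, hc, h⟩ := exists_hasDerivAt_eq_slope g g' zero_lt_one
    (fun t _ => (hg t).continuousAt.continuousWithinAt) (fun t _ => hg t)
  have := hM c hc
  rw [h] at this
  simpa using this

/-- A function on `[0, ∞)` whose derivative is at most that of a comparison function. -/
theorem le_of_deriv_le {g g' k k' : ℝ → ℝ} (hg : ∀ t, HasDerivAt g (g' t) t)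
    (hk : ∀ t, HasDerivAt k (k' t) t) (h0 : g 0 ≤ k 0)
    {b : ℝ} (h : ∀ t, 0 ≤ t → t ≤ b → g' t ≤ k' t) :
    ∀ t, 0 ≤ t → t ≤ b → g t ≤ k t := by
  intro t ht htb
  have hmono : MonotoneOn (fun s => k s - g s) (Set.Icc 0 b) := by
    refine monotoneOn_of_hasDerivWithinAt_nonneg (f' := fun s => k' s - g' s) (convex_Icc 0 b)
      (fun s _ => ((hk s).sub (hg s)).continuousAt.continuousWithinAt)
      (fun s _ => ((hk s).sub (hg s)).hasDerivWithinAt) ?_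
    intro s hs
    rw [interior_Icc] at hs
    exact sub_nonneg.2 (h s hs.1.le hs.2.le)
  have := hmono (Set.left_mem_Icc.2 (ht.trans htb)) ⟨ht, htb⟩ ht
  simp only at this
  linarith

variable {G : E → ℝ} {G' : E → E →L[ℝ] ℝ} {G'' : E → E →L[ℝ] E →L[ℝ] ℝ}

theorem gradient_monotone (hG' : ∀ y, HasFDerivAt G' (G'' y) y)
    (hpos : ∀ y w, 0 ≤ G'' y w w) (u v : E) : 0 ≤ (G' v - G' u) (v - u) := by
  have := sub_le_of_deriv_le (g := fun t => -G' (u + t • (v - u)) (v - u)) (M := 0)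
    (fun t => (hasDerivAt_comp_line_apply hG' u (v - u) (v - u) t).neg)
    (fun t _ => neg_nonpos.2 (hpos _ _))
  simp only [one_smul, zero_smul, add_zero, add_sub_cancel] at this
  rw [sub_apply]
  linarith

theorem add_gradient_le (hG : ∀ y, HasFDerivAt G (G' y) y)
    (hG' : ∀ y, HasFDerivAt G' (G'' y) y)
    (hpos : ∀ y w, 0 ≤ G'' y w w) (u v : E) : G u + G' u (v - u) ≤ G v := by
  have := sub_le_of_deriv_le (g := fun t => -G (u + t • (v - u))) (M := -G' u (v - u))
    (fun t => (hasDerivAt_comp_line hG u (v - u) t).neg)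
    (fun t ht => by
      have := gradient_monotone hG' hpos u (u + t • (v - u))
      rw [add_sub_cancel_left, map_smul, smul_eq_mul, sub_apply] at this
      have := nonneg_of_mul_nonneg_right this ht.1
      linarith)
  simp only [one_smul, zero_smul, add_zero, add_sub_cancel] at this
  linarith

/-- Cocoercivity of the gradient on a segment on which the Hessian is bounded by `M`. -/
theorem gradient_cocoercive (hG' : ∀ y, HasFDerivAt G' (G'' y) y)
    (hsymm : ∀ y w z, G'' y w z = G'' y z w) (hpos : ∀ y w, 0 ≤ G'' y w w)
    {u v : E} {M : ℝ} (hM0 : 0 ≤ M)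
    (hM : ∀ y ∈ segment ℝ u v, ∀ z, G'' y z z ≤ M * ‖z‖ ^ 2) :
    ‖G' v - G' u‖ ^ 2 ≤ M * (G' v - G' u) (v - u) := by
  set D := G' v - G' u with hD
  have hDw : 0 ≤ D (v - u) := gradient_monotone hG' hpos u v
  -- With `w = v - u`, expanding `G''(w - z, w - z) ≥ 0` gives `G''(w, z) - G''(w, w)/2 ≤ G''(z,
  -- z)/2` pointwise. Integrating along the segment uses the bound `M` only there, whereas the usual
  -- argument by the descent lemma leaves the segment.
  have key : ∀ z, D z ≤ 1 / 2 * D (v - u) + M / 2 * ‖z‖ ^ 2 := by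
    intro z
    have := sub_le_of_deriv_le
      (g := fun t => G' (u + t • (v - u)) z - 1 / 2 * G' (u + t • (v - u)) (v - u))
      (M := M / 2 * ‖z‖ ^ 2)
      (fun t => (hasDerivAt_comp_line_apply hG' u (v - u) z t).sub
        ((hasDerivAt_comp_line_apply hG' u (v - u) (v - u) t).const_mul _))
      (fun t ht => by
        have hseg : u + t • (v - u) ∈ segment ℝ u v := by
          rw [segment_eq_image']
          exact ⟨t, ⟨ht.1.le, ht.2.le⟩, rfl⟩
        have h1 := hM _ hseg z
        have h2 := hpos (u + t • (v - u)) (v - u - z)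
        simp only [map_sub, sub_apply] at h2
        have h3 := hsymm (u + t • (v - u)) v z
        have h4 := hsymm (u + t • (v - u)) u z
        simp only [map_sub, sub_apply]
        linarith)
    simp only [one_smul, zero_smul, add_zero, add_sub_cancel] at this
    simp only [hD, sub_apply]
    linarith
  have hle : ∀ z, (D z) ^ 2 ≤ (M * D (v - u)) * ‖z‖ ^ 2 := by
    intro z
    -- Replacing `z` by `s • z` turns `key` into a quadratic in `s` that is nonnegative everywhere.
    have hd : discrim (M / 2 * ‖z‖ ^ 2) (-(D z)) (1 / 2 * D (v - u)) ≤ 0 := by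
      apply discrim_le_zero
      intro s
      have := key (s • z)
      rw [map_smul, smul_eq_mul, norm_smul, mul_pow, Real.norm_eq_abs, sq_abs] at this
      nlinarith
    rw [discrim] at hd
    nlinarith
  have hb : ‖D‖ ≤ √(M * D (v - u)) := by
    refine D.opNorm_le_bound (Real.sqrt_nonneg _) fun z => ?_
    rw [Real.norm_eq_abs, ← Real.sqrt_sq (norm_nonneg z), ← Real.sqrt_mul (by positivity)]
    exact Real.abs_le_sqrt (hle z)
  calc ‖D‖ ^ 2 ≤ √(M * D (v - u)) ^ 2 := by gcongr
    _ = _ := Real.sq_sqrt (by positivity)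

end SecondOrder

/-! ### Derivatives of powers of the norm -/

section NormPower

variable {E : Type*} [NormedAddCommGroup E] [InnerProductSpace ℝ E]

/-- The real inner product as a bilinear form. -/
def innerL : E →L[ℝ] E →L[ℝ] ℝ := (isBoundedBilinearMap_inner (𝕜 := ℝ)).toContinuousLinearMap

@[simp]
theorem innerL_apply (u v : E) : innerL u v = inner ℝ u v := rfl

theorem innerL_eq (u : E) : innerL u = innerSL ℝ u := rfl

theorem norm_innerL_apply (u : E) : ‖innerL u‖ = ‖u‖ := by
  rw [innerL_eq, innerSL_apply_norm]

/-- The Hessian of `‖h‖ ^ (q + 2) / (q + 2)`. -/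
def normPowHess (q : ℝ) (h : E) : E →L[ℝ] E →L[ℝ] ℝ :=
  ‖h‖ ^ q • innerL + (innerL h).smulRight ((q * ‖h‖ ^ (q - 2)) • innerL h)

theorem normPowHess_apply (q : ℝ) (h w z : E) : normPowHess q h w z =
    ‖h‖ ^ q * inner ℝ w z + q * ‖h‖ ^ (q - 2) * (inner ℝ h w * inner ℝ h z) := by
  simp [normPowHess]
  ring

theorem normPowHess_symm (q : ℝ) (h w z : E) : normPowHess q h w z = normPowHess q h z w := by
  rw [normPowHess_apply, normPowHess_apply, real_inner_comm]
  ring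

theorem le_normPowHess {q : ℝ} (hq : 0 ≤ q) (h w : E) :
    ‖h‖ ^ q * ‖w‖ ^ 2 ≤ normPowHess q h w w := by
  rw [normPowHess_apply, real_inner_self_eq_norm_sq]
  have := mul_self_nonneg (inner ℝ h w)
  have : 0 ≤ q * ‖h‖ ^ (q - 2) * (inner ℝ h w * inner ℝ h w) := by positivity
  linarith

theorem normPowHess_le {q : ℝ} (hq : 0 < q) (h w : E) :
    normPowHess q h w w ≤ (1 + q) * ‖h‖ ^ q * ‖w‖ ^ 2 := by
  rw [normPowHess_apply, real_inner_self_eq_norm_sq]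
  have h1 : inner ℝ h w * inner ℝ h w ≤ ‖h‖ ^ 2 * ‖w‖ ^ 2 := by
    have := abs_real_inner_le_norm h w
    rw [← mul_pow, ← pow_two]
    exact sq_le_sq.2 (by rwa [abs_of_nonneg (by positivity : 0 ≤ ‖h‖ * ‖w‖)])
  have h2 : ‖h‖ ^ (q - 2) * ‖h‖ ^ 2 = ‖h‖ ^ q := by
    rcases eq_or_ne h 0 with rfl | hh
    · simp [Real.zero_rpow hq.ne']
    · rw [← Real.rpow_natCast, ← Real.rpow_add (norm_pos_iff.2 hh)]
      norm_num
  calc _ ≤ ‖h‖ ^ q * ‖w‖ ^ 2 + q * ‖h‖ ^ (q - 2) * (‖h‖ ^ 2 * ‖w‖ ^ 2) := by gcongr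
    _ = ‖h‖ ^ q * ‖w‖ ^ 2 + q * (‖h‖ ^ (q - 2) * ‖h‖ ^ 2) * ‖w‖ ^ 2 := by ring
    _ = _ := by rw [h2]; ring

/-- At the origin the map has norm `‖w‖^q ‖w‖ = o(‖w‖)`, so its derivative vanishes, in agreement
with the formula: there the possibly singular factor `‖h‖^(q-2)` multiplies `innerL 0 = 0`.
Elsewhere `(‖h‖²)^(q/2)` is differentiable. -/
theorem hasFDerivAt_normPow_smul {q : ℝ} (hq : 0 < q) (h : E) :
    HasFDerivAt (fun h : E => ‖h‖ ^ q • innerL h) (normPowHess q h) h := by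
  rcases eq_or_ne h 0 with rfl | hh
  · have hz : normPowHess q (0 : E) = 0 := by
      ext w z
      simp [normPowHess_apply, Real.zero_rpow hq.ne']
    rw [hz, hasFDerivAt_iff_isLittleO_nhds_zero]
    simp only [zero_add, norm_zero, map_zero, smul_zero, sub_zero, zero_apply]
    rw [Asymptotics.isLittleO_iff]
    intro c hc
    have ht : Filter.Tendsto (fun h : E => ‖h‖ ^ q) (nhds 0) (nhds 0) := by
      have : Continuous fun h : E => ‖h‖ ^ q := continuous_norm.rpow_const fun _ => Or.inr hq.le
      simpa [Real.zero_rpow hq.ne'] using this.tendsto 0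
    filter_upwards [ht.eventually (gt_mem_nhds hc)] with w hw
    rw [norm_smul, Real.norm_of_nonneg (by positivity), norm_innerL_apply]
    gcongr
  · have h1 : HasFDerivAt (fun h : E => (‖h‖ ^ 2) ^ (q / 2))
        ((q / 2 * (‖h‖ ^ 2) ^ (q / 2 - 1)) • (2 • innerL h)) h :=
      (hasStrictFDerivAt_norm_sq h).hasFDerivAt.rpow_const
        (Or.inl (by positivity))
    have e : ∀ k : E, ∀ r : ℝ, (‖k‖ ^ 2) ^ (r / 2) = ‖k‖ ^ r := by
      intro k r
      rw [← Real.rpow_natCast, ← Real.rpow_mul (norm_nonneg _)]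
      congr 1
      push_cast
      ring
    have e' : q / 2 - 1 = (q - 2) / 2 := by ring
    simp only [e', e] at h1
    have h2 := h1.smul (innerL (E := E)).hasFDerivAt
    refine h2.congr_fderiv ?_
    ext w z
    simp [normPowHess]
    ring

end NormPower

end BregmanTensor

end

/-! ### Second and third derivatives as multilinear forms -/

noncomputable section
namespace BregmanTensor

variable {E : Type*} [NormedAddCommGroup E] [InnerProductSpace ℝ E]

/-- The Hessian as a bilinear form. -/
def hess (f : E → ℝ) : E → E →L[ℝ] E →L[ℝ] ℝ := fderiv ℝ (fderiv ℝ f)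

/-- The third derivative as a trilinear form. -/
def third (f : E → ℝ) : E → E →L[ℝ] E →L[ℝ] E →L[ℝ] ℝ := fderiv ℝ (hess f)

theorem iteratedFDeriv_two_eq (f : E → ℝ) (x : E) (m : Fin 2 → E) :
    iteratedFDeriv ℝ 2 f x m = hess f x (m 0) (m 1) :=
  iteratedFDeriv_two_apply f x m

theorem iteratedFDeriv_three_eq (f : E → ℝ) (x : E) (m : Fin 3 → E) :
    iteratedFDeriv ℝ 3 f x m = third f x (m 0) (m 1) (m 2) := by
  rw [iteratedFDeriv_succ_apply_right, iteratedFDeriv_two_apply]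
  rfl

theorem differentiable_of_iteratedFDeriv_zero {F : Type*} [NormedAddCommGroup F] [NormedSpace ℝ F]
    {f : E → F} (h : Differentiable ℝ (iteratedFDeriv ℝ 0 f)) : Differentiable ℝ f := by
  rw [iteratedFDeriv_zero_eq_comp] at h
  exact (LinearIsometryEquiv.comp_differentiable_iff _).1 h

theorem differentiable_iteratedFDeriv_fderiv {F : Type*} [NormedAddCommGroup F] [NormedSpace ℝ F]
    {f : E → F} {n : ℕ} (h : Differentiable ℝ (iteratedFDeriv ℝ (n + 1) f)) :
    Differentiable ℝ (iteratedFDeriv ℝ n (fderiv ℝ f)) := by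
  have e : iteratedFDeriv ℝ (n + 1) f = (continuousMultilinearCurryRightEquiv' ℝ n E F).symm ∘
      iteratedFDeriv ℝ n (fderiv ℝ f) := by
    ext1 x
    exact iteratedFDeriv_succ_eq_comp_right
  rw [e] at h
  exact (LinearIsometryEquiv.comp_differentiable_iff _).1 h

namespace ThriceDifferentiable

variable {f : E → ℝ}

theorem hasFDerivAt (hf : ThriceDifferentiable f) (y : E) : HasFDerivAt f (fderiv ℝ f y) y :=
  (differentiable_of_iteratedFDeriv_zero (hf 0 (by norm_num)) y).hasFDerivAt

theorem hasFDerivAt_fderiv (hf : ThriceDifferentiable f) (y : E) : HasFDerivAt (fderiv ℝ f) (hess f y) y :=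
  (differentiable_of_iteratedFDeriv_zero
    (differentiable_iteratedFDeriv_fderiv (hf 1 (by norm_num))) y).hasFDerivAt

theorem hasFDerivAt_hess (hf : ThriceDifferentiable f) (y : E) : HasFDerivAt (hess f) (third f y) y :=
  (differentiable_of_iteratedFDeriv_zero (differentiable_iteratedFDeriv_fderiv
    (differentiable_iteratedFDeriv_fderiv (hf 2 (by norm_num)))) y).hasFDerivAt

theorem hess_symm (hf : ThriceDifferentiable f) (y w z : E) : hess f y w z = hess f y z w :=
  second_derivative_symmetric hf.hasFDerivAt (hf.hasFDerivAt_fderiv y) w z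

theorem third_symm_left (hf : ThriceDifferentiable f) (y u w z : E) : third f y u w z = third f y w u z := by
  rw [second_derivative_symmetric hf.hasFDerivAt_fderiv (hf.hasFDerivAt_hess y) u w]

theorem hasFDerivAt_hess_apply (hf : ThriceDifferentiable f) (y a b : E) :
    HasFDerivAt (fun y => hess f y a b) (((third f y).flip a).flip b) y := by
  have := ((hf.hasFDerivAt_hess y).clm_apply (hasFDerivAt_const a y)).clm_apply
    (hasFDerivAt_const b y)
  refine this.congr_fderiv ?_
  ext
  simp

theorem hasDerivAt_hess_line (hf : ThriceDifferentiable f) (x s w : E) (t : ℝ) :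
    HasDerivAt (fun t : ℝ => hess f (x + t • s) w w) (third f (x + t • s) s w w) t :=
  hasDerivAt_comp_line (fun y => hf.hasFDerivAt_hess_apply y w w) x s t

/-- Differentiate the symmetry of the Hessian. With `third_symm_left`, which is Schwarz's theorem
for the gradient, this gives full symmetry. -/
theorem third_symm_right (hf : ThriceDifferentiable f) (y u w z : E) :
    third f y u w z = third f y u z w := by
  have h1 := hf.hasFDerivAt_hess_apply y w z
  simp only [fun y => hf.hess_symm y w z] at h1
  simpa using DFunLike.congr_fun (h1.unique (hf.hasFDerivAt_hess_apply y z w)) u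

theorem hess_nonneg (hf : ThriceDifferentiable f) (hconv : ConvexOn ℝ Set.univ f) (y w : E) : 0 ≤ hess f y w w := by
  have hg (t : ℝ) := hasDerivAt_comp_line hf.hasFDerivAt y w t
  have hg' := hasDerivAt_comp_line_apply hf.hasFDerivAt_fderiv y w w 0
  have hc : ConvexOn ℝ Set.univ fun t : ℝ => f (y + t • w) := by
    have := hconv.comp_affineMap (AffineMap.lineMap y (y + w) : ℝ →ᵃ[ℝ] E)
    simpa [Function.comp_def, AffineMap.lineMap_apply, add_comm] using this
  have hm : Monotone fun t : ℝ => fderiv ℝ f (y + t • w) w := by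
    have := hc.monotoneOn_deriv fun t _ => (hg t).differentiableAt
    rw [monotoneOn_univ] at this
    rwa [funext fun t => (hg t).deriv] at this
  have h := hm.deriv_nonneg (x := 0)
  rw [hg'.deriv] at h
  simpa using h

end ThriceDifferentiable

theorem HolderThirdDeriv.third_sub_le {f : E → ℝ} {ν Hf : ℝ} (h : HolderThirdDeriv f ν Hf)
    (u v a b c : E) :
    |third f u a b c - third f v a b c| ≤ Hf * ‖u - v‖ ^ ν * (‖a‖ * ‖b‖ * ‖c‖) := by
  have h1 := (iteratedFDeriv ℝ 3 f u - iteratedFDeriv ℝ 3 f v).le_opNorm ![a, b, c]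
  rw [sub_apply, iteratedFDeriv_three_eq, iteratedFDeriv_three_eq, Fin.prod_univ_three] at h1
  exact h1.trans (mul_le_mul_of_nonneg_right (h u v) (by positivity))

theorem abs_hess_le (f : E → ℝ) (x w z : E) :
    |hess f x w z| ≤ ‖iteratedFDeriv ℝ 2 f x‖ * (‖w‖ * ‖z‖) := by
  have h1 := (iteratedFDeriv ℝ 2 f x).le_opNorm ![w, z]
  rwa [iteratedFDeriv_two_eq, Fin.prod_univ_two] at h1

/-! ### Gradients and Hessians of the model and of the scaling function -/

section Model

variable (f : E → ℝ) (ν H : ℝ) (x : E)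

def omegaGrad (y : E) : E →L[ℝ] ℝ :=
  fderiv ℝ f x + hess f x (y - x) + (1 / 2 : ℝ) • third f x (y - x) (y - x) +
    (H / 6 * (3 + ν)) • ‖y - x‖ ^ (1 + ν) • innerL (y - x)

def omegaHess (y : E) : E →L[ℝ] E →L[ℝ] ℝ :=
  hess f x + third f x (y - x) + (H / 6 * (3 + ν)) • normPowHess (1 + ν) (y - x)

def rhoGrad (y : E) : E →L[ℝ] ℝ := hess f x (y - x) + ‖y - x‖ ^ (1 + ν) • innerL (y - x)

def rhoHess (y : E) : E →L[ℝ] E →L[ℝ] ℝ := hess f x + normPowHess (1 + ν) (y - x)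

variable {f ν H x}

theorem taylor3_eq (y : E) : taylor3 f x y = f x + (fderiv ℝ f x (y - x) +
    1 / 2 * hess f x (y - x) (y - x) + 1 / 6 * third f x (y - x) (y - x) (y - x)) := by
  have : Finset.Icc 1 3 = {1, 2, 3} := rfl
  rw [taylor3, this, Finset.sum_insert (by decide), Finset.sum_pair (by decide),
    iteratedFDeriv_one_apply, iteratedFDeriv_two_eq, iteratedFDeriv_three_eq]
  norm_num [Nat.factorial]
  ring

theorem rho_eq (y : E) : rho f ν x y =
    1 / 2 * hess f x (y - x) (y - x) + 1 / (3 + ν) * ‖y - x‖ ^ (3 + ν) := by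
  rw [rho, iteratedFDeriv_two_eq]

theorem hasFDerivAt_norm_sub_rpow (hν : 0 ≤ ν) (y : E) :
    HasFDerivAt (fun y => ‖y - x‖ ^ (3 + ν))
      ((3 + ν) • ‖y - x‖ ^ (1 + ν) • innerL (y - x)) y := by
  have := (hasFDerivAt_norm_rpow (y - x) (by linarith : 1 < 3 + ν)).comp y
    ((hasFDerivAt_id y).sub_const x)
  rw [show 3 + ν - 2 = 1 + ν by ring] at this
  rw [smul_smul, innerL_eq]
  exact this

theorem hasFDerivAt_clm_sub {F : Type*} [NormedAddCommGroup F] [NormedSpace ℝ F] (A : E →L[ℝ] F)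
    (x y : E) : HasFDerivAt (fun y => A (y - x)) A y := by
  have := A.hasFDerivAt.comp y ((hasFDerivAt_id y).sub_const x)
  rwa [ContinuousLinearMap.comp_id] at this

theorem hasFDerivAt_sub_const_id (x y : E) :
    HasFDerivAt (fun y => y - x) (ContinuousLinearMap.id ℝ E) y :=
  (hasFDerivAt_id y).sub_const x

theorem hasFDerivAt_hess_quadratic (hf : ThriceDifferentiable f) (y : E) :
    HasFDerivAt (fun y => hess f x (y - x) (y - x)) ((2 : ℝ) • hess f x (y - x)) y := by
  have h := hasFDerivAt_clm_sub (hess f x) x y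
  have := h.clm_apply (hasFDerivAt_sub_const_id x y)
  refine this.congr_fderiv ?_
  ext w
  generalize y - x = k
  simp [hf.hess_symm x w]
  ring

theorem hasFDerivAt_third_quadratic (hf : ThriceDifferentiable f) (y : E) :
    HasFDerivAt (fun y => third f x (y - x) (y - x)) ((2 : ℝ) • third f x (y - x)) y := by
  have h := hasFDerivAt_clm_sub (F := E →L[ℝ] E →L[ℝ] ℝ) (third f x) x y
  have := h.clm_apply (hasFDerivAt_sub_const_id x y)
  refine this.congr_fderiv ?_
  ext w z
  generalize y - x = k
  simp [hf.third_symm_left x w]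
  ring

theorem hasFDerivAt_third_cubic (hf : ThriceDifferentiable f) (y : E) :
    HasFDerivAt (fun y => third f x (y - x) (y - x) (y - x))
      ((3 : ℝ) • third f x (y - x) (y - x)) y := by
  have := (hasFDerivAt_third_quadratic (x := x) hf y).clm_apply (hasFDerivAt_sub_const_id x y)
  refine this.congr_fderiv ?_
  ext w
  generalize y - x = k
  simp [hf.third_symm_right x k w]
  ring

theorem hasFDerivAt_rho (hf : ThriceDifferentiable f) (hν : 0 ≤ ν) (y : E) :
    HasFDerivAt (rho f ν x) (rhoGrad f ν x y) y := by
  have := ((hasFDerivAt_hess_quadratic (x := x) hf y).const_mul (1 / 2)).add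
    ((hasFDerivAt_norm_sub_rpow (x := x) hν y).const_mul (1 / (3 + ν)))
  rw [show rho f ν x = _ from funext rho_eq]
  refine this.congr_fderiv ?_
  have : (3 + ν) ≠ 0 := by positivity
  ext w
  simp [rhoGrad]
  field_simp

theorem hasFDerivAt_taylor3 (hf : ThriceDifferentiable f) (y : E) :
    HasFDerivAt (taylor3 f x) (fderiv ℝ f x + hess f x (y - x) +
      (1 / 2 : ℝ) • third f x (y - x) (y - x)) y := by
  have := ((((hasFDerivAt_clm_sub (fderiv ℝ f x) x y).add
    ((hasFDerivAt_hess_quadratic (x := x) hf y).const_mul (1 / 2))).add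
    ((hasFDerivAt_third_cubic (x := x) hf y).const_mul (1 / 6)))).const_add (f x)
  rw [show taylor3 f x = _ from funext taylor3_eq]
  refine this.congr_fderiv ?_
  ext w
  simp
  ring

theorem hasFDerivAt_omega (hf : ThriceDifferentiable f) (hν : 0 ≤ ν) (y : E) :
    HasFDerivAt (omega f ν H x) (omegaGrad f ν H x y) y := by
  have := (hasFDerivAt_taylor3 (x := x) hf y).add
    ((hasFDerivAt_norm_sub_rpow (x := x) hν y).const_mul (H / 6))
  refine this.congr_fderiv ?_
  ext w
  simp [omegaGrad]
  ring

theorem hasFDerivAt_normPow_sub (hν : 0 ≤ ν) (y : E) :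
    HasFDerivAt (fun y => ‖y - x‖ ^ (1 + ν) • innerL (y - x)) (normPowHess (1 + ν) (y - x)) y :=
  (hasFDerivAt_normPow_smul (by linarith : 0 < 1 + ν) (y - x)).comp y
    ((hasFDerivAt_id y).sub_const x)

theorem hasFDerivAt_rhoGrad (hν : 0 ≤ ν) (y : E) :
    HasFDerivAt (rhoGrad f ν x) (rhoHess f ν x y) y :=
  (hasFDerivAt_clm_sub (hess f x) x y).add
    (hasFDerivAt_normPow_sub hν y)

theorem hasFDerivAt_omegaGrad (hf : ThriceDifferentiable f) (hν : 0 ≤ ν) (y : E) :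
    HasFDerivAt (omegaGrad f ν H x) (omegaHess f ν H x y) y := by
  have := (((hasFDerivAt_clm_sub (hess f x) x y).const_add (fderiv ℝ f x)).add
    ((hasFDerivAt_third_quadratic (x := x) hf y).const_smul (1 / 2 : ℝ))).add
    ((hasFDerivAt_normPow_sub (x := x) hν y).const_smul (H / 6 * (3 + ν)))
  refine this.congr_fderiv ?_
  ext w z
  simp [omegaHess]

end Model

end BregmanTensor

end

/-! ### The constants, relative bounds on the Hessian, and majorization -/

noncomputable section
namespace BregmanTensor

variable {E : Type*} [NormedAddCommGroup E] [InnerProductSpace ℝ E]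

section Constants

variable {ν Hf H : ℝ}

theorem one_le_tauH_base (hν : 0 ≤ ν) (hHf : 0 < Hf) (hH : 2 * Hf ≤ H) :
    1 ≤ (3 + ν) * H / (6 * Hf) := by
  rw [le_div_iff₀ (by positivity)]
  nlinarith

theorem one_le_tauH (hν : 0 ≤ ν) (hHf : 0 < Hf) (hH : 2 * Hf ≤ H) : 1 ≤ tauH ν Hf H :=
  Real.one_le_rpow (one_le_tauH_base hν hHf hH) (by positivity)

theorem one_lt_tauH (hν : 0 ≤ ν) (hHf : 0 < Hf) (hH : 2 * Hf ≤ H) (h : 0 < ν ∨ 2 * Hf < H) :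
    1 < tauH ν Hf H := by
  refine Real.one_lt_rpow ?_ (by positivity)
  rw [lt_div_iff₀ (by positivity)]
  rcases h with h | h <;> nlinarith

/-- This identity is the reason for the choice of `τ`: it rewrites the weight of the norm-power term
in `∇²Ω`. -/
theorem tauH_rpow (hν : 0 ≤ ν) (hHf : 0 < Hf) (hH : 2 * Hf ≤ H) :
    H / 6 * (3 + ν) = tauH ν Hf H ^ (1 + ν) * Hf := by
  have h1 := one_le_tauH_base hν hHf hH
  rw [tauH, ← Real.rpow_mul (by linarith), one_div, inv_mul_cancel₀ (by positivity), Real.rpow_one]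
  field_simp

theorem one_le_LH (hν : 0 ≤ ν) (hHf : 0 < Hf) (hH : 2 * Hf ≤ H) : 1 ≤ LH ν Hf H := by
  have h1 := one_le_tauH hν hHf hH
  refine le_max_of_le_left ?_
  rw [le_div_iff₀ (by linarith)]
  linarith

theorem muH_lt_one (hν : 0 ≤ ν) (hHf : 0 < Hf) (hH : 2 * Hf ≤ H) : muH ν Hf H < 1 := by
  have h1 := one_le_tauH hν hHf hH
  refine min_lt_of_left_lt ?_
  rw [div_lt_one (by linarith)]
  linarith

theorem muH_nonneg (hν : 0 ≤ ν) (hHf : 0 < Hf) (hH : 2 * Hf ≤ H) : 0 ≤ muH ν Hf H := by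
  have h1 := one_le_tauH hν hHf hH
  have h2 := sub_nonneg.2 h1
  exact le_min (by positivity) (by positivity)

theorem muH_pos (hν : 0 ≤ ν) (hHf : 0 < Hf) (hH : 2 * Hf ≤ H) (h : 0 < ν ∨ 2 * Hf < H) :
    0 < muH ν Hf H := by
  have h1 := one_lt_tauH hν hHf hH h
  have h2 := sub_pos.2 h1
  have h3 : 0 < tauH ν Hf H := by linarith
  exact lt_min (by positivity) (by positivity)

end Constants

variable {f : E → ℝ} {ν Hf H : ℝ}

/-- Mean value inequality on `t ↦ ∇²f(x + ts)[w, w]`. Bounding `‖ts‖^ν` by `‖s‖^ν` gives up a factor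
`1/(1+ν)` but avoids integrating a fractional power. -/
theorem hess_add_le (hν : 0 ≤ ν) (hHf : 0 < Hf) (hf : ThriceDifferentiable f)
    (hh : HolderThirdDeriv f ν Hf) (x s w : E) :
    hess f (x + s) w w ≤
      hess f x w w + third f x s w w + Hf * ‖s‖ ^ (1 + ν) * ‖w‖ ^ 2 := by
  have := sub_le_of_deriv_le
    (g := fun t => hess f (x + t • s) w w) (g' := fun t => third f (x + t • s) s w w)
    (M := third f x s w w + Hf * ‖s‖ ^ (1 + ν) * ‖w‖ ^ 2)
    (hf.hasDerivAt_hess_line x s w)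
    (fun t ht => by
      have h1 := (le_abs_self _).trans (hh.third_sub_le (x + t • s) x s w w)
      have h2 : ‖x + t • s - x‖ ^ ν ≤ ‖s‖ ^ ν := by
        rw [add_sub_cancel_left, norm_smul, Real.norm_of_nonneg ht.1.le]
        have := ht.1
        exact Real.rpow_le_rpow (by positivity) (mul_le_of_le_one_left (norm_nonneg s) ht.2.le) hν
      have h3 : ‖s‖ ^ (1 + ν) = ‖s‖ * ‖s‖ ^ ν := by
        rw [Real.rpow_add_of_nonneg (norm_nonneg s) zero_le_one hν, Real.rpow_one]
      have h4 : Hf * ‖x + t • s - x‖ ^ ν * (‖s‖ * ‖w‖ * ‖w‖) ≤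
          Hf * ‖s‖ ^ ν * (‖s‖ * ‖w‖ * ‖w‖) := by gcongr
      rw [h3]
      linarith)
  simp only [one_smul, zero_smul, add_zero] at this
  linarith

/-- The third derivative is dominated by the second one and the Hölder term. -/
theorem mul_abs_third_le (hν : 0 ≤ ν) (hHf : 0 < Hf) (hf : ThriceDifferentiable f)
    (hconv : ConvexOn ℝ Set.univ f) (hh : HolderThirdDeriv f ν Hf) {τ : ℝ} (hτ : 0 < τ)
    (x h w : E) :
    τ * |third f x h w w| ≤ hess f x w w + Hf * τ ^ (1 + ν) * ‖h‖ ^ (1 + ν) * ‖w‖ ^ 2 := by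
  -- Nonnegativity of the Hessian at `x + τh` and at `x - τh` bounds the third-order term from both
  -- sides.
  have h1 := (hf.hess_nonneg hconv _ w).trans
    (hess_add_le hν hHf hf hh x (τ • h) w)
  have h2 := (hf.hess_nonneg hconv _ w).trans
    (hess_add_le hν hHf hf hh x (-(τ • h)) w)
  rw [norm_neg] at h2
  rw [norm_smul, Real.norm_of_nonneg hτ.le, Real.mul_rpow hτ.le (norm_nonneg h)] at h1 h2
  simp only [map_neg, map_smul, neg_apply, smul_apply, smul_eq_mul] at h1 h2
  rcases abs_cases (third f x h w w) with ⟨e, _⟩ | ⟨e, _⟩ <;> rw [e] <;> linarith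

variable {x : E}

theorem rhoHess_nonneg (hν : 0 ≤ ν) (hf : ThriceDifferentiable f)
    (hconv : ConvexOn ℝ Set.univ f) (y w : E) : 0 ≤ rhoHess f ν x y w w := by
  have h1 := hf.hess_nonneg hconv x w
  have h2 := le_normPowHess (by linarith : 0 ≤ 1 + ν) (y - x) w
  have h3 : 0 ≤ ‖y - x‖ ^ (1 + ν) * ‖w‖ ^ 2 := by positivity
  simp only [rhoHess, add_apply]
  linarith

/-- With `A = ∇²f(x)` and `P` the Hessian of the norm power, `∇²Ω = A + C + τ^(1+ν) H_f P`, where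
the cubic term satisfies `|C| ≤ A/τ + τ^ν H_f P`. Collecting the coefficients of `A` and of `P`
yields the two entries of the minimum and of the maximum. -/
theorem omegaHess_bounds (hν : 0 ≤ ν) (hHf : 0 < Hf) (hH : 2 * Hf ≤ H)
    (hf : ThriceDifferentiable f) (hconv : ConvexOn ℝ Set.univ f) (hh : HolderThirdDeriv f ν Hf)
    (y w : E) :
    muH ν Hf H * rhoHess f ν x y w w ≤ omegaHess f ν H x y w w ∧
      omegaHess f ν H x y w w ≤ LH ν Hf H * rhoHess f ν x y w w := by
  have hτ := one_le_tauH hν hHf hH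
  have hL1 : _ ≤ LH ν Hf H := le_max_left _ _
  have hL2 : _ ≤ LH ν Hf H := le_max_right _ _
  have hm1 : muH ν Hf H ≤ _ := min_le_left _ _
  have hm2 : muH ν Hf H ≤ _ := min_le_right _ _
  simp only [rhoHess, omegaHess, add_apply, smul_apply, smul_eq_mul]
  rw [tauH_rpow hν hHf hH]
  set τ := tauH ν Hf H
  have hτ0 : 0 < τ := by linarith
  have h1 := hf.hess_nonneg hconv x w
  have h2 := le_normPowHess (by linarith : 0 ≤ 1 + ν) (y - x) w
  have h3 := mul_abs_third_le hν hHf hf hconv hh hτ0 x (y - x) w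
  set A := hess f x w w
  set C := third f x (y - x) w w
  set P := normPowHess (1 + ν) (y - x) w w
  have hτν : τ ^ (1 + ν) = τ * τ ^ ν := by
    rw [Real.rpow_add hτ0, Real.rpow_one]
  have hQ : 0 < τ ^ ν := by positivity
  rw [hτν] at h3 ⊢
  set Q := τ ^ ν
  have hP : 0 ≤ P := le_trans (by positivity) h2
  have h4 : |C| ≤ A / τ + Hf * Q * P := by
    have : τ * |C| ≤ A + τ * (Hf * Q * P) := by
      have : Hf * (τ * Q) * (‖y - x‖ ^ (1 + ν) * ‖w‖ ^ 2) ≤ Hf * (τ * Q) * P := by gcongr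
      linarith
    rw [← mul_le_mul_iff_right₀ hτ0]
    calc _ ≤ _ := this
      _ = _ := by field_simp
  have h5 := abs_le.1 h4
  constructor
  · calc _ = muH ν Hf H * A + muH ν Hf H * P := by ring
      _ ≤ (τ - 1) / τ * A + Q * (τ - 1) * Hf * P := by gcongr
      _ = A + τ * Q * Hf * P - (A / τ + Hf * Q * P) := by field_simp
      _ ≤ _ := by linarith
  · calc A + C + τ * Q * Hf * P ≤ A + τ * Q * Hf * P + (A / τ + Hf * Q * P) := by linarith
      _ = (τ + 1) / τ * A + Q * (τ + 1) * Hf * P := by field_simp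
      _ ≤ LH ν Hf H * A + LH ν Hf H * P := by gcongr
      _ = _ := by ring

/-- The `12 R₀²` in `Nx` comes from `(2+ν)(2R₀)^(1+ν) ≤ 3 · 4R₀²`. -/
theorem rhoHess_le {R₀ : ℝ} (hν : ν ∈ Set.Icc (0 : ℝ) 1) (hR : 1 ≤ R₀) {y : E}
    (hy : ‖y - x‖ ≤ 2 * R₀) (z : E) : rhoHess f ν x y z z ≤ Nx f x R₀ * ‖z‖ ^ 2 := by
  obtain ⟨hν0, hν1⟩ := hν
  have h1 := (le_abs_self _).trans (abs_hess_le f x z z)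
  have h2 := normPowHess_le (by linarith : 0 < 1 + ν) (y - x) z
  have h3 : ‖y - x‖ ^ (1 + ν) ≤ 4 * R₀ ^ 2 := by
    calc ‖y - x‖ ^ (1 + ν) ≤ (2 * R₀) ^ (1 + ν) := by gcongr
      _ ≤ (2 * R₀) ^ (2 : ℝ) := Real.rpow_le_rpow_of_exponent_le (by linarith) (by linarith)
      _ = _ := by rw [Real.rpow_two]; ring
  have h4 : (1 + (1 + ν)) * ‖y - x‖ ^ (1 + ν) * ‖z‖ ^ 2 ≤ 3 * (4 * R₀ ^ 2) * ‖z‖ ^ 2 := by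
    gcongr
    linarith
  simp only [rhoHess, add_apply, Nx]
  linarith

theorem rho_le {R₀ : ℝ} (hν : ν ∈ Set.Icc (0 : ℝ) 1) (hR : 1 ≤ R₀) {y : E}
    (hy : ‖y - x‖ ≤ 2 * R₀) : rho f ν x y ≤ 3 * Nx f x R₀ ^ 2 := by
  obtain ⟨hν0, hν1⟩ := hν
  have h1 := (le_abs_self _).trans (abs_hess_le f x (y - x) (y - x))
  have h3 : ‖y - x‖ ^ (3 + ν) ≤ 16 * R₀ ^ 4 := by
    calc ‖y - x‖ ^ (3 + ν) ≤ (2 * R₀) ^ (3 + ν) := by gcongr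
      _ ≤ (2 * R₀) ^ (4 : ℝ) := Real.rpow_le_rpow_of_exponent_le (by linarith) (by linarith)
      _ = (2 * R₀) ^ (4 : ℕ) := by rw [← Real.rpow_natCast]; norm_num
      _ = _ := by ring
  have h4 : 1 / (3 + ν) * ‖y - x‖ ^ (3 + ν) ≤ 1 * (16 * R₀ ^ 4) := by
    gcongr
    rw [div_le_one (by linarith)]
    linarith
  have h5 : ‖iteratedFDeriv ℝ 2 f x‖ * (‖y - x‖ * ‖y - x‖) ≤
      ‖iteratedFDeriv ℝ 2 f x‖ * ((2 * R₀) * (2 * R₀)) := by gcongr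
  have h6 := norm_nonneg (iteratedFDeriv ℝ 2 f x)
  have h7 : 0 ≤ ‖iteratedFDeriv ℝ 2 f x‖ * R₀ ^ 2 := by positivity
  have h8 : 0 ≤ R₀ ^ 4 := by positivity
  rw [rho_eq, Nx]
  nlinarith

/-- Along the segment from `x` to `y` the third derivative exceeds its value at `x` by at most `M =
H_f ‖h‖^(3+ν)`. Three integrations turn this into the Taylor polynomial plus `M/6`. -/
theorem le_omega (hν : 0 ≤ ν) (hHf : 0 < Hf) (hH : 2 * Hf ≤ H)
    (hf : ThriceDifferentiable f) (hh : HolderThirdDeriv f ν Hf) (y : E) :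
    f y ≤ omega f ν H x y := by
  obtain ⟨h, rfl⟩ : ∃ h, y = x + h := ⟨y - x, by abel⟩
  set M := Hf * ‖h‖ ^ (3 + ν) with hM
  have d0 := hasDerivAt_comp_line hf.hasFDerivAt x h
  have d1 := hasDerivAt_comp_line_apply hf.hasFDerivAt_fderiv x h h
  have d2 := hf.hasDerivAt_hess_line x h h
  have k2 : ∀ t : ℝ, HasDerivAt (fun t => hess f x h h + t * (third f x h h h + M))
      (third f x h h h + M) t := fun t => by
    simpa using ((hasDerivAt_id t).mul_const (third f x h h h + M)).const_add (hess f x h h)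
  have k1 : ∀ t : ℝ, HasDerivAt (fun t => fderiv ℝ f x h + t * hess f x h h +
      t ^ 2 * ((third f x h h h + M) / 2)) (hess f x h h + t * (third f x h h h + M)) t :=
    fun t => by
      refine ((((hasDerivAt_id t).mul_const (hess f x h h)).const_add (fderiv ℝ f x h)).add
        ((hasDerivAt_pow 2 t).mul_const ((third f x h h h + M) / 2))).congr_deriv ?_
      norm_num
      ring
  have k0 : ∀ t : ℝ, HasDerivAt (fun t => f x + t * fderiv ℝ f x h + t ^ 2 * (hess f x h h / 2) +
      t ^ 3 * ((third f x h h h + M) / 6)) (fderiv ℝ f x h + t * hess f x h h +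
      t ^ 2 * ((third f x h h h + M) / 2)) t :=
    fun t => by
      refine (((((hasDerivAt_id t).mul_const (fderiv ℝ f x h)).const_add (f x)).add
        ((hasDerivAt_pow 2 t).mul_const (hess f x h h / 2))).add
        ((hasDerivAt_pow 3 t).mul_const ((third f x h h h + M) / 6))).congr_deriv ?_
      norm_num
      ring
  have e3 : ∀ t : ℝ, 0 ≤ t → t ≤ 1 → third f (x + t • h) h h h ≤ third f x h h h + M := by
    intro t ht0 ht1
    have h1 := (le_abs_self _).trans (hh.third_sub_le (x + t • h) x h h h)
    have h2 : ‖x + t • h - x‖ ^ ν ≤ ‖h‖ ^ ν := by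
      rw [add_sub_cancel_left, norm_smul, Real.norm_of_nonneg ht0]
      exact Real.rpow_le_rpow (by positivity) (mul_le_of_le_one_left (norm_nonneg h) ht1) hν
    have h3 : ‖h‖ ^ (3 + ν) = ‖h‖ * ‖h‖ * ‖h‖ * ‖h‖ ^ ν := by
      rw [Real.rpow_add_of_nonneg (norm_nonneg h) (by norm_num) hν,
        show (3 : ℝ) = (3 : ℕ) by norm_num, Real.rpow_natCast]
      ring
    have h4 : Hf * ‖x + t • h - x‖ ^ ν * (‖h‖ * ‖h‖ * ‖h‖) ≤
        Hf * ‖h‖ ^ ν * (‖h‖ * ‖h‖ * ‖h‖) := by gcongr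
    rw [hM, h3]
    linarith
  have e2 := le_of_deriv_le d2 k2 (by simp) e3
  have e1 := le_of_deriv_le d1 k1 (by simp) e2
  have e0 := le_of_deriv_le d0 k0 (by simp) e1 1 zero_le_one le_rfl
  simp only [one_smul, one_mul, one_pow] at e0
  rw [omega, taylor3_eq, add_sub_cancel_left]
  have : M ≤ H * ‖h‖ ^ (3 + ν) := by
    rw [hM]
    gcongr
    linarith
  linarith

end BregmanTensor

end

/-! ### Optimality of the proximal step and one-step inequalities -/

noncomputable section
namespace BregmanTensor

theorem mem_effDom_of_isMinOn {X : Type*} {φ : X → EReal} {g : X → ℝ} {p z : X} (hz : z ∈ effDom φ)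
    (hp : IsMinOn (fun z => (g z : EReal) + φ z) Set.univ p) : p ∈ effDom φ := by
  intro h
  have := hp (Set.mem_univ z)
  simp only [Set.mem_ofPred_eq, h, EReal.coe_add_top, top_le_iff] at this
  exact EReal.add_ne_top (EReal.coe_ne_top _) hz this

variable {E : Type*} [NormedAddCommGroup E] [InnerProductSpace ℝ E]

section ClosedConvex

variable {φ : E → EReal}

theorem IsClosedConvex.coe_toReal (hφ : IsClosedConvex φ) {z : E} (hz : z ∈ effDom φ) :
    ((φ z).toReal : EReal) = φ z := EReal.coe_toReal hz (hφ.ne_bot z)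

/-- First-order optimality condition for the sum of a differentiable and a convex function. -/
theorem IsClosedConvex.neg_fderiv_mem_subdiff (hφ : IsClosedConvex φ) (hdom : (effDom φ).Nonempty)
    {g : E → ℝ} {g' : E →L[ℝ] ℝ} {p : E} (hg : HasFDerivAt g g' p)
    (hp : IsMinOn (fun z => (g z : EReal) + φ z) Set.univ p) : -g' ∈ subdiff φ p := by
  obtain ⟨z₀, hz₀⟩ := hdom
  have hpd := mem_effDom_of_isMinOn hz₀ hp
  refine ⟨hpd, fun z => ?_⟩
  by_cases hz : φ z = ⊤
  · rw [hz]
    exact le_top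
  have hz : z ∈ effDom φ := hz
  rw [← hφ.coe_toReal hpd, ← hφ.coe_toReal hz]
  set a := (φ p).toReal with ha
  set b := (φ z).toReal with hb
  -- Minimality at `p` is tested on the segment towards `z`, with `φ` replaced by its chord; letting
  -- `t → 0+` leaves the derivative of `g` alone.
  have hle : ∀ t ∈ Set.Ioo (0 : ℝ) 1, g p ≤ g (p + t • (z - p)) + t * (b - a) := by
    intro t ht
    have h1 : φ (p + t • (z - p)) ≤ (((1 - t) * a + t * b : ℝ) : EReal) := by
      have := hφ.convex_epi (x := (p, a)) (by simp [ha, hφ.coe_toReal hpd])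
        (y := (z, b)) (by simp [hb, hφ.coe_toReal hz]) (sub_nonneg.2 ht.2.le) ht.1.le
        (sub_add_cancel 1 t)
      simp only [Set.mem_ofPred_eq, Prod.smul_mk, Prod.mk_add_mk, smul_eq_mul] at this
      convert this using 2
      module
    have h2 : (g p : EReal) + φ p ≤ (g (p + t • (z - p)) : EReal) + φ (p + t • (z - p)) :=
      hp (Set.mem_univ _)
    have h3 := h2.trans (add_le_add_right h1 _)
    rw [← hφ.coe_toReal hpd, ← EReal.coe_add, ← EReal.coe_add, EReal.coe_le_coe_iff] at h3
    linarith
  have hd : HasDerivAt (fun t : ℝ => g (p + t • (z - p)) + t * (b - a))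
      (g' (z - p) + (b - a)) 0 := by
    have h1 : HasDerivAt (fun s : ℝ => p + s • (z - p)) (z - p) 0 := by
      simpa using ((hasDerivAt_id (0 : ℝ)).smul_const (z - p)).const_add p
    have h2 : HasFDerivAt g g' (p + (0 : ℝ) • (z - p)) := by simpa using hg
    refine ((h2.comp_hasDerivAt (0 : ℝ) h1).add
      ((hasDerivAt_id (0 : ℝ)).mul_const (b - a))).congr_deriv ?_
    simp
  have hpos : 0 ≤ g' (z - p) + (b - a) := by
    refine ge_of_tendsto hd.tendsto_slope_zero_right ?_
    filter_upwards [Ioo_mem_nhdsGT (zero_lt_one' ℝ)] with t ht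
    have := hle t ht
    simp only [zero_add, zero_smul, add_zero, zero_mul, smul_eq_mul]
    exact mul_nonneg (inv_nonneg.2 ht.1.le) (by linarith)
  rw [← EReal.coe_add, EReal.coe_le_coe_iff, neg_apply]
  linarith

theorem IsClosedConvex.toReal_add_le (hφ : IsClosedConvex φ) {s : E →L[ℝ] ℝ} {p z : E}
    (hs : s ∈ subdiff φ p) (hz : z ∈ effDom φ) : (φ p).toReal + s (z - p) ≤ (φ z).toReal := by
  have := hs.2 z
  rwa [← hφ.coe_toReal hs.1, ← hφ.coe_toReal hz, ← EReal.coe_add, EReal.coe_le_coe_iff] at this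

end ClosedConvex

variable {f : E → ℝ} {φ : E → EReal} {ν Hf H R₀ : ℝ} {x : E} {y : ℕ → E}

theorem bregman_rho_eq (hν : 0 ≤ ν) (hf : ThriceDifferentiable f) (u v : E) :
    bregman (rho f ν x) u v = rho f ν x v - rho f ν x u - rhoGrad f ν x u (v - u) := by
  rw [bregman, (hasFDerivAt_rho hf hν u).fderiv]

theorem bregman_rho_nonneg (hν : 0 ≤ ν) (hf : ThriceDifferentiable f)
    (hconv : ConvexOn ℝ Set.univ f) (u v : E) : 0 ≤ bregman (rho f ν x) u v := by
  have := add_gradient_le (hasFDerivAt_rho (x := x) hf hν) (hasFDerivAt_rhoGrad hν)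
    (rhoHess_nonneg hν hf hconv) u v
  rw [bregman_rho_eq hν hf]
  linarith

/-- `L_H`-smoothness of `Ω` relative to `ρ`. -/
theorem omega_le (hν : 0 ≤ ν) (hHf : 0 < Hf) (hH : 2 * Hf ≤ H)
    (hf : ThriceDifferentiable f) (hconv : ConvexOn ℝ Set.univ f) (hh : HolderThirdDeriv f ν Hf)
    (u v : E) : omega f ν H x v ≤ omega f ν H x u + omegaGrad f ν H x u (v - u) +
      LH ν Hf H * bregman (rho f ν x) u v := by
  have := add_gradient_le
    (fun y => ((hasFDerivAt_rho (x := x) hf hν y).const_smul (LH ν Hf H)).sub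
      (hasFDerivAt_omega (H := H) (x := x) hf hν y))
    (fun y => ((hasFDerivAt_rhoGrad (f := f) (x := x) hν y).const_smul (LH ν Hf H)).sub
      (hasFDerivAt_omegaGrad (H := H) (x := x) hf hν y))
    (fun y w => sub_nonneg.2 (omegaHess_bounds hν hHf hH hf hconv hh y w).2) u v
  simp only [Pi.sub_apply, Pi.smul_apply, sub_apply, smul_apply, smul_eq_mul] at this
  rw [bregman_rho_eq hν hf]
  linarith

/-- `μ_H`-strong convexity of `Ω` relative to `ρ`. -/
theorem le_omega_of_gradient (hν : 0 ≤ ν) (hHf : 0 < Hf) (hH : 2 * Hf ≤ H)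
    (hf : ThriceDifferentiable f) (hconv : ConvexOn ℝ Set.univ f) (hh : HolderThirdDeriv f ν Hf)
    (u v : E) : omega f ν H x u + omegaGrad f ν H x u (v - u) +
      muH ν Hf H * bregman (rho f ν x) u v ≤ omega f ν H x v := by
  have := add_gradient_le
    (fun y => (hasFDerivAt_omega (H := H) (x := x) hf hν y).sub
      ((hasFDerivAt_rho (x := x) hf hν y).const_smul (muH ν Hf H)))
    (fun y => (hasFDerivAt_omegaGrad (H := H) (x := x) hf hν y).sub
      ((hasFDerivAt_rhoGrad (f := f) (x := x) hν y).const_smul (muH ν Hf H)))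
    (fun y w => sub_nonneg.2 (omegaHess_bounds hν hHf hH hf hconv hh y w).1) u v
  simp only [Pi.sub_apply, Pi.smul_apply, sub_apply, smul_apply, smul_eq_mul] at this
  rw [bregman_rho_eq hν hf]
  linarith

theorem gPhi_succ (hν : 0 ≤ ν) (hf : ThriceDifferentiable f) (k : ℕ) :
    gPhi f ν Hf H x y (k + 1) = (2 * LH ν Hf H) • (rhoGrad f ν x (y k) - rhoGrad f ν x (y (k + 1)))
      - omegaGrad f ν H x (y k) := by
  rw [gPhi, Nat.add_sub_cancel, (hasFDerivAt_rho hf hν _).fderiv, (hasFDerivAt_rho hf hν _).fderiv,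
    (hasFDerivAt_omega hf hν _).fderiv]

theorem IsBregmanProxSeq.gPhi_mem_subdiff (hy : IsBregmanProxSeq f φ ν Hf H x y) (hν : 0 ≤ ν)
    (hf : ThriceDifferentiable f) (hφ : IsClosedConvex φ) (hdom : (effDom φ).Nonempty) (k : ℕ) :
    gPhi f ν Hf H x y (k + 1) ∈ subdiff φ (y (k + 1)) := by
  have h := hy.step k
  rw [(hasFDerivAt_omega hf hν _).fderiv] at h
  simp only [bregman_rho_eq hν hf] at h
  have hd : HasFDerivAt (fun z => omegaGrad f ν H x (y k) (z - y k) + 2 * LH ν Hf H *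
      (rho f ν x z - rho f ν x (y k) - rhoGrad f ν x (y k) (z - y k)))
      (omegaGrad f ν H x (y k) + (2 * LH ν Hf H) •
        (rhoGrad f ν x (y (k + 1)) - rhoGrad f ν x (y k))) (y (k + 1)) :=
    (hasFDerivAt_clm_sub _ _ _).add ((((hasFDerivAt_rho hf hν _).sub_const _).sub
      (hasFDerivAt_clm_sub _ _ _)).const_mul _)
  have := hφ.neg_fderiv_mem_subdiff hdom hd h
  convert this using 1
  rw [gPhi_succ hν hf]
  module

/-- The objective of the Bregman proximal gradient method on the effective domain. -/
def modelValue (f : E → ℝ) (φ : E → EReal) (ν H : ℝ) (x z : E) : ℝ :=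
  omega f ν H x z + (φ z).toReal

/-- Add the subgradient inequality at `y_{k+1}`, relative smoothness from `y_k` to `y_{k+1}` and
relative strong convexity from `y_k` to `z`, then use the three-point identity of `β_ρ`. The
leftover `-L_H β_ρ(y_k, y_{k+1})` is dropped. -/
theorem modelValue_sub_le (hy : IsBregmanProxSeq f φ ν Hf H x y) (hν : 0 ≤ ν) (hHf : 0 < Hf)
    (hH : 2 * Hf ≤ H) (hf : ThriceDifferentiable f) (hconv : ConvexOn ℝ Set.univ f)
    (hh : HolderThirdDeriv f ν Hf) (hφ : IsClosedConvex φ) (hdom : (effDom φ).Nonempty) (k : ℕ)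
    {z : E} (hz : z ∈ effDom φ) :
    modelValue f φ ν H x (y (k + 1)) - modelValue f φ ν H x z ≤
      (2 * LH ν Hf H - muH ν Hf H) * bregman (rho f ν x) (y k) z -
        2 * LH ν Hf H * bregman (rho f ν x) (y (k + 1)) z := by
  have h1 := hφ.toReal_add_le (hy.gPhi_mem_subdiff hν hf hφ hdom k) hz
  have h2 := omega_le (x := x) hν hHf hH hf hconv hh (y k) (y (k + 1))
  have h3 := le_omega_of_gradient (x := x) hν hHf hH hf hconv hh (y k) z
  have h4 := bregman_rho_nonneg (x := x) hν hf hconv (y k) (y (k + 1))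
  have h5 := one_le_LH hν hHf hH
  have h6 := mul_nonneg (zero_le_one.trans h5) h4
  rw [gPhi_succ hν hf] at h1
  simp only [bregman_rho_eq hν hf, modelValue, sub_apply, smul_apply, smul_eq_mul, map_sub] at *
  linarith

/-- The factor `2 L_H` in the step pays off here: relative smoothness consumes only `L_H β_ρ(y_k,
y_{k+1})`, at most `L_H` times the symmetrized distance, and the same amount remains as decrease. -/
theorem le_modelValue_sub (hy : IsBregmanProxSeq f φ ν Hf H x y) (hν : 0 ≤ ν) (hHf : 0 < Hf)
    (hH : 2 * Hf ≤ H) (hf : ThriceDifferentiable f) (hconv : ConvexOn ℝ Set.univ f)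
    (hh : HolderThirdDeriv f ν Hf) (hφ : IsClosedConvex φ) (hdom : (effDom φ).Nonempty) (k : ℕ)
    (hk : y k ∈ effDom φ) :
    LH ν Hf H * (rhoGrad f ν x (y (k + 1)) - rhoGrad f ν x (y k)) (y (k + 1) - y k) ≤
      modelValue f φ ν H x (y k) - modelValue f φ ν H x (y (k + 1)) := by
  have h1 := hφ.toReal_add_le (hy.gPhi_mem_subdiff hν hf hφ hdom k) hk
  have h2 := omega_le (x := x) hν hHf hH hf hconv hh (y k) (y (k + 1))
  have h4 := bregman_rho_nonneg (x := x) hν hf hconv (y (k + 1)) (y k)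
  have h5 := one_le_LH hν hHf hH
  have h6 := mul_nonneg (zero_le_one.trans h5) h4
  rw [gPhi_succ hν hf] at h1
  simp only [bregman_rho_eq hν hf, modelValue, sub_apply, smul_apply, smul_eq_mul, map_sub] at *
  linarith

theorem rhoHess_symm (hf : ThriceDifferentiable f) (u w z : E) :
    rhoHess f ν x u w z = rhoHess f ν x u z w := by
  simp only [rhoHess, add_apply]
  rw [hf.hess_symm, normPowHess_symm]

theorem omegaHess_symm (hf : ThriceDifferentiable f) (u w z : E) :
    omegaHess f ν H x u w z = omegaHess f ν H x u z w := by
  simp only [omegaHess, add_apply, smul_apply]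
  rw [hf.hess_symm, normPowHess_symm, hf.third_symm_right]

/-- Cocoercivity for `2 L_H ρ - Ω`: its Hessian is nonnegative by relative smoothness and, since
`∇²Ω ≥ 0`, at most `2 L_H ∇²ρ`, hence at most `2 L_H N_x` on the ball of radius `2R₀`. -/
theorem sq_norm_gradient_le (hy : IsBregmanProxSeq f φ ν Hf H x y) (hν : ν ∈ Set.Icc (0 : ℝ) 1)
    (hHf : 0 < Hf) (hH : 2 * Hf ≤ H) (hf : ThriceDifferentiable f)
    (hconv : ConvexOn ℝ Set.univ f) (hh : HolderThirdDeriv f ν Hf) (hφ : IsClosedConvex φ)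
    (hdom : (effDom φ).Nonempty) (hR : 1 ≤ R₀) (k : ℕ) (hk : y k ∈ effDom φ)
    (hk0 : ‖y k - x‖ ≤ 2 * R₀) (hk1 : ‖y (k + 1) - x‖ ≤ 2 * R₀) :
    ‖fderiv ℝ (omega f ν H x) (y (k + 1)) + gPhi f ν Hf H x y (k + 1)‖ ^ 2 ≤
      4 * LH ν Hf H * Nx f x R₀ *
        (modelValue f φ ν H x (y k) - modelValue f φ ν H x (y (k + 1))) := by
  have hL := one_le_LH hν.1 hHf hH
  have hN : 0 ≤ Nx f x R₀ := by
    rw [Nx]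
    positivity
  have hρ0 := rhoHess_nonneg (x := x) hν.1 hf hconv
  have hΩ0 : ∀ u w, 0 ≤ omegaHess f ν H x u w w := fun u w =>
    (mul_nonneg (muH_nonneg hν.1 hHf hH) (hρ0 u w)).trans
      (omegaHess_bounds hν.1 hHf hH hf hconv hh u w).1
  have h1 := gradient_cocoercive (M := 2 * LH ν Hf H * Nx f x R₀) (u := y k) (v := y (k + 1))
    (fun y => ((hasFDerivAt_rhoGrad (f := f) (x := x) hν.1 y).const_smul (2 * LH ν Hf H)).sub
      (hasFDerivAt_omegaGrad (H := H) (x := x) hf hν.1 y))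
    (fun u w z => by
      simp only [sub_apply, smul_apply]
      rw [rhoHess_symm hf, omegaHess_symm hf])
    (fun u w => by
      have h2 := (omegaHess_bounds (x := x) hν.1 hHf hH hf hconv hh u w).2
      have h3 := mul_nonneg (zero_le_one.trans hL) (hρ0 u w)
      simp only [sub_apply, smul_apply, smul_eq_mul]
      linarith)
    (by positivity)
    (fun u hu z => by
      have hball : u ∈ Metric.closedBall x (2 * R₀) :=
        (convex_closedBall x (2 * R₀)).segment_subset (by simpa [dist_eq_norm] using hk0)
          (by simpa [dist_eq_norm] using hk1) hu
      rw [Metric.mem_closedBall, dist_eq_norm] at hball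
      have h2 := rhoHess_le (f := f) hν hR hball z
      have h3 := hΩ0 u z
      have h4 := mul_le_mul_of_nonneg_left h2 (by linarith : 0 ≤ 2 * LH ν Hf H)
      simp only [sub_apply, smul_apply, smul_eq_mul]
      linarith)
  have h2 := le_modelValue_sub hy hν.1 hHf hH hf hconv hh hφ hdom k hk
  have h3 := gradient_monotone (hasFDerivAt_omegaGrad (H := H) (x := x) hf hν.1) hΩ0
    (y k) (y (k + 1))
  rw [(hasFDerivAt_omega hf hν.1 _).fderiv, gPhi_succ hν.1 hf, ← norm_neg]
  -- The negated composite gradient is the increment of `2 L_H ∇ρ - ∇Ω` from `y_k` to `y_{k+1}`.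
  have e : ∀ a b c d : E →L[ℝ] ℝ, ∀ l : ℝ,
      -(a + (l • (b - c) - d)) = (l • c - a) - (l • b - d) := fun a b c d l => by module
  rw [e]
  refine h1.trans ?_
  have h4 := mul_nonneg (zero_le_one.trans hL) hN
  have h5 : ∀ a b : ℝ, a ≤ 2 * b →
      2 * LH ν Hf H * Nx f x R₀ * a ≤ 4 * LH ν Hf H * Nx f x R₀ * b := fun a b hab => by
    nlinarith
  apply h5
  simp only [Pi.sub_apply, Pi.smul_apply, sub_apply, smul_apply, smul_eq_mul] at h2 h3 ⊢
  linarith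

end BregmanTensor

end

/-! ### Confinement of the iterates and the iteration bound -/

noncomputable section
namespace BregmanTensor

variable {E : Type*} [NormedAddCommGroup E] [InnerProductSpace ℝ E]
  {f : E → ℝ} {φ : E → EReal} {ν Hf H R₀ : ℝ} {x : E} {y : ℕ → E}

theorem omega_self (hν : 0 ≤ ν) : omega f ν H x x = f x := by
  have : (3 + ν) ≠ 0 := by positivity
  simp [omega, taylor3_eq, Real.zero_rpow this]

theorem bregman_rho_base (hν : 0 ≤ ν) (hf : ThriceDifferentiable f) (z : E) :
    bregman (rho f ν x) x z = rho f ν x z := by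
  have h : (3 + ν) ≠ 0 := by positivity
  rw [bregman_rho_eq hν hf, rho_eq x]
  simp [rhoGrad, Real.zero_rpow h]

/-- A one-step recursion with contraction factor `(a - μ) / a`. -/
theorem pow_sub_one_mul_le {a μ D : ℝ} {b : ℕ → ℝ} {T : ℕ} (hμ : 0 < μ) (hμa : μ < a)
    (h : ∀ k < T, D ≤ (a - μ) * b k - a * b (k + 1)) (hb : 0 ≤ b T) :
    ((a / (a - μ)) ^ T - 1) * D ≤ μ * b 0 := by
  have ha : 0 < a - μ := sub_pos.2 hμa
  have ha0 : 0 < a := hμ.trans hμa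
  set r := a / (a - μ) with hr
  have hr0 : 0 < r := by positivity
  -- Equivalently `r^k (μ b_k + D) ≤ μ b_0 + D`: the shifted quantity `μ b_k + D` shrinks by the
  -- factor `1/r` at each step.
  have key : ∀ k ≤ T, (r ^ k - 1) * D + μ * r ^ k * b k ≤ μ * b 0 := by
    intro k
    induction k with
    | zero => simp
    | succ k ih =>
      intro hk
      have h1 := ih (by omega)
      have h2 := h k (by omega)
      have h3 : (r - 1) * D + μ * r * b (k + 1) ≤ μ * b k := by
        have e : (r - 1) * D + μ * r * b (k + 1) = μ / (a - μ) * (D + a * b (k + 1)) := by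
          rw [hr]
          field_simp
          ring
        rw [e]
        calc μ / (a - μ) * (D + a * b (k + 1)) ≤ μ / (a - μ) * ((a - μ) * b k) := by
              gcongr
              linarith
          _ = _ := by field_simp
      have h4 := mul_le_mul_of_nonneg_left h3 (pow_nonneg hr0.le k)
      rw [pow_succ]
      linarith
  have := key T le_rfl
  have : 0 ≤ μ * r ^ T * b T := by positivity
  linarith

/-- If `φ x = ⊤`, then the value at `x₀` is also `⊤` and the sublevel set is the whole space, which
is nonzero and so not bounded. -/
theorem mem_effDom_of_bounded_sublevel (hdom : (effDom φ).Nonempty) {x₀ xstar : E}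
    (hx : composite f φ x ≤ composite f φ x₀)
    (hsub : ∀ z, composite f φ z ≤ composite f φ x₀ → ‖z - xstar‖ ≤ R₀) : x ∈ effDom φ := by
  intro h
  obtain ⟨z, hz⟩ := hdom
  have hzx : z - x ≠ 0 := fun e => hz (by rw [sub_eq_zero.1 e, h])
  have htop : composite f φ x₀ = ⊤ := by
    rw [composite, h, EReal.coe_add_top] at hx
    exact top_le_iff.1 hx
  have hR : 0 ≤ R₀ := (norm_nonneg _).trans (hsub z (by rw [htop]; exact le_top))
  have h1 := hsub (xstar + ((R₀ + 1) / ‖z - x‖) • (z - x)) (by rw [htop]; exact le_top)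
  rw [add_sub_cancel_left, norm_smul, Real.norm_of_nonneg (by positivity),
    div_mul_cancel₀ _ (norm_ne_zero_iff.2 hzx)] at h1
  linarith

theorem IsBregmanProxSeq.mem_effDom (hy : IsBregmanProxSeq f φ ν Hf H x y)
    (hx : x ∈ effDom φ) (k : ℕ) : y k ∈ effDom φ := by
  cases k with
  | zero => rwa [hy.init]
  | succ k => exact mem_effDom_of_isMinOn hx (hy.step k)

theorem IsBregmanProxSeq.antitone_modelValue (hy : IsBregmanProxSeq f φ ν Hf H x y) (hν : 0 ≤ ν)
    (hHf : 0 < Hf) (hH : 2 * Hf ≤ H) (hf : ThriceDifferentiable f)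
    (hconv : ConvexOn ℝ Set.univ f) (hh : HolderThirdDeriv f ν Hf) (hφ : IsClosedConvex φ)
    (hx : x ∈ effDom φ) : Antitone fun k => modelValue f φ ν H x (y k) := by
  refine antitone_nat_of_succ_le fun k => ?_
  have h1 := le_modelValue_sub hy hν hHf hH hf hconv hh hφ ⟨x, hx⟩ k (hy.mem_effDom hx k)
  have h2 := gradient_monotone (hasFDerivAt_rhoGrad (f := f) (x := x) hν)
    (rhoHess_nonneg hν hf hconv) (y k) (y (k + 1))
  have h3 := mul_nonneg (zero_le_one.trans (one_le_LH hν hHf hH)) h2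
  linarith

theorem IsBregmanProxSeq.composite_le (hy : IsBregmanProxSeq f φ ν Hf H x y) (hν : 0 ≤ ν)
    (hHf : 0 < Hf) (hH : 2 * Hf ≤ H) (hf : ThriceDifferentiable f)
    (hconv : ConvexOn ℝ Set.univ f) (hh : HolderThirdDeriv f ν Hf) (hφ : IsClosedConvex φ)
    (hx : x ∈ effDom φ) (k : ℕ) : composite f φ (y k) ≤ composite f φ x := by
  have h1 := hy.antitone_modelValue hν hHf hH hf hconv hh hφ hx (Nat.zero_le k)
  have h2 := le_omega (x := x) hν hHf hH hf hh (y k)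
  simp only [hy.init, modelValue, omega_self hν] at h1
  rw [composite, composite, ← hφ.coe_toReal hx, ← hφ.coe_toReal (hy.mem_effDom hx k),
    ← EReal.coe_add, ← EReal.coe_add, EReal.coe_le_coe_iff]
  linarith

/-- The argument of the logarithm defining `KxH` dominates `24 L_H N_x³ μ_H`. -/
theorem le_KxH_arg (hν : 0 ≤ ν) {L N μ : ℝ} (hL : 1 ≤ L) (hN : 0 ≤ N) (hμ : 0 ≤ μ) :
    24 * L * N ^ 3 * μ ≤ 4 * (3 + ν) * (2 * L) ^ (2 + ν) * N ^ 3 * μ / 2 ^ (-(1 + ν)) := by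
  have h1 : 2 * L ≤ (2 * L) ^ (2 + ν) :=
    Real.self_le_rpow_of_one_le (by linarith) (by linarith)
  have h2 : (2 : ℝ) ^ (-(1 + ν)) ≤ 1 :=
    Real.rpow_le_one_of_one_le_of_nonpos (by norm_num) (by linarith)
  have h3 : (0 : ℝ) < 2 ^ (-(1 + ν)) := by positivity
  rw [le_div_iff₀ h3]
  calc 24 * L * N ^ 3 * μ * 2 ^ (-(1 + ν)) ≤ 24 * L * N ^ 3 * μ * 1 := by gcongr
    _ = 4 * 3 * (2 * L) * N ^ 3 * μ := by ring
    _ ≤ _ := by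
      gcongr
      linarith

theorem iteration_bound {x₀ xstar : E} (hν : ν ∈ Set.Icc (0 : ℝ) 1)
    (hHf : 0 < Hf) (hf : ThriceDifferentiable f) (hconv : ConvexOn ℝ Set.univ f)
    (hh : HolderThirdDeriv f ν Hf) (hφ : IsClosedConvex φ) (hx : x ∈ effDom φ)
    (hx0 : composite f φ x ≤ composite f φ x₀) (hR : 1 ≤ R₀)
    (hsub : ∀ z, composite f φ z ≤ composite f φ x₀ → ‖z - xstar‖ ≤ R₀) (hH : 2 * Hf ≤ H)
    (hy : IsBregmanProxSeq f φ ν Hf H x y) (hpos : 0 < ν ∨ 2 * Hf < H) {ε : ℝ} {T : ℕ}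
    (hε : ε ∈ Set.Ioo (0 : ℝ) 1)
    (hT : ε < ‖fderiv ℝ (omega f ν H x) (y (T + 1)) + gPhi f ν Hf H x y (T + 1)‖) :
    (T : ℝ) * Real.logb 2 (2 * LH ν Hf H / (2 * LH ν Hf H - muH ν Hf H)) ≤
      max 1 (KxH f ν Hf H x R₀ + (3 + ν) * Real.logb 2 ε⁻¹) := by
  have hL := one_le_LH hν.1 hHf hH
  have hμ := muH_pos hν.1 hHf hH hpos
  have hμ1 := muH_lt_one hν.1 hHf hH
  have hN : 0 < Nx f x R₀ := by
    rw [Nx]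
    positivity
  have hball : ∀ k, ‖y k - x‖ ≤ 2 * R₀ := fun k => by
    have h1 := hsub (y k)
      ((hy.composite_le hν.1 hHf hH hf hconv hh hφ hx k).trans hx0)
    have h2 := hsub x hx0
    calc ‖y k - x‖ = ‖(y k - xstar) - (x - xstar)‖ := by rw [sub_sub_sub_cancel_right]
      _ ≤ _ := (norm_sub_le _ _).trans (by linarith)
  have hanti := hy.antitone_modelValue hν.1 hHf hH hf hconv hh hφ hx
  have hgrad := sq_norm_gradient_le hy hν hHf hH hf hconv hh hφ ⟨x, hx⟩ hR T
    (hy.mem_effDom hx T) (hball T) (hball (T + 1))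
  set D := modelValue f φ ν H x (y T) - modelValue f φ ν H x (y (T + 1)) with hD
  -- The comparison point is the last iterate. For `k < T` monotonicity puts the model value at
  -- `y_{k+1}` above that at `y_T`, so every gap is at least `D`.
  have hrate := pow_sub_one_mul_le (D := D) (b := fun k => bregman (rho f ν x) (y k) (y (T + 1)))
    (T := T) hμ (by linarith : muH ν Hf H < 2 * LH ν Hf H)
    (fun k hk => by
      refine le_trans ?_ (modelValue_sub_le hy hν.1 hHf hH hf hconv hh hφ ⟨x, hx⟩ k
        (hy.mem_effDom hx (T + 1)))
      exact sub_le_sub_right (hanti hk) _)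
    (bregman_rho_nonneg hν.1 hf hconv _ _)
  simp only [hy.init, bregman_rho_base hν.1 hf] at hrate
  have hρ := rho_le (f := f) hν hR (hball (T + 1))
  rw [KxH]
  set L := LH ν Hf H
  set μ := muH ν Hf H
  set N := Nx f x R₀
  set r := 2 * L / (2 * L - μ) with hr
  have hr1 : 1 < r := by
    rw [hr, lt_div_iff₀ (by linarith)]
    linarith
  rw [← Real.logb_pow]
  -- If `r^T ≤ 2`, the entry `1` of the maximum suffices; otherwise `r^T ≤ 2 (r^T - 1)`.
  rcases le_or_gt (r ^ T) 2 with h2 | h2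
  · refine le_max_of_le_left ?_
    rwa [Real.logb_le_iff_le_rpow one_lt_two (by positivity), Real.rpow_one]
  refine le_max_of_le_right ?_
  set W := 4 * (3 + ν) * (2 * L) ^ (2 + ν) * N ^ 3 * μ / 2 ^ (-(1 + ν)) with hW
  have hW1 : 24 * L * N ^ 3 * μ ≤ W := le_KxH_arg hν.1 hL hN.le hμ.le
  have hε0 := hε.1
  have hε2 : ε ^ 2 ≤ 4 * L * N * D := (pow_le_pow_left₀ hε0.le hT.le 2).trans hgrad
  have hε3 : ε ^ (3 + ν) ≤ ε ^ 2 := by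
    rw [← Real.rpow_two]
    exact Real.rpow_le_rpow_of_exponent_ge hε0 hε.2.le (by linarith [hν.1])
  have hmain : r ^ T * ε ^ (3 + ν) ≤ W := by
    calc r ^ T * ε ^ (3 + ν) ≤ (2 * (r ^ T - 1)) * (4 * L * N * D) := by
          gcongr
          · linarith
          · linarith
          · exact hε3.trans hε2
      _ = 8 * L * N * ((r ^ T - 1) * D) := by ring
      _ ≤ 8 * L * N * (μ * (3 * N ^ 2)) := by
          refine mul_le_mul_of_nonneg_left (hrate.trans ?_) (by positivity)
          gcongr
      _ = 24 * L * N ^ 3 * μ := by ring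
      _ ≤ W := hW1
  have hlog := Real.logb_le_logb_of_le one_lt_two (by positivity) hmain
  rw [Real.logb_mul (by positivity) (by positivity), Real.logb_rpow_eq_mul_logb_of_pos hε0] at hlog
  rw [Real.logb_inv]
  linarith

end BregmanTensor

end

theorem theorem4p2 {E : Type*} [NormedAddCommGroup E] [InnerProductSpace ℝ E]
    [FiniteDimensional ℝ E]
    (f : E → ℝ) (φ : E → EReal) (ν Hf H R₀ : ℝ) (x₀ x xstar : E) (y : ℕ → E)
    (hν : ν ∈ Set.Icc (0 : ℝ) 1) (hHf : 0 < Hf)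
    (hf_diff : ThriceDifferentiable f) (hf_conv : ConvexOn ℝ Set.univ f)
    (hf_holder : HolderThirdDeriv f ν Hf)
    (hφ : IsClosedConvex φ) (hφ_dom : (intrinsicInterior ℝ (effDom φ)).Nonempty)
    (hxstar : ∀ z, composite f φ xstar ≤ composite f φ z)
    (hx : composite f φ x ≤ composite f φ x₀)
    (hR₀ : 1 ≤ R₀) (hsub : ∀ z, composite f φ z ≤ composite f φ x₀ → ‖z - xstar‖ ≤ R₀)
    (hH : 2 * Hf ≤ H)
    (hy : IsBregmanProxSeq f φ ν Hf H x y) :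
    (∀ k, 1 ≤ k → gPhi f ν Hf H x y k ∈ subdiff φ (y k)) ∧
    ((0 < ν ∨ 2 * Hf < H) →
      ∀ (ε : ℝ) (T : ℕ), ε ∈ Set.Ioo (0 : ℝ) 1 →
        ε < ‖fderiv ℝ (omega f ν H x) (y (T + 1)) + gPhi f ν Hf H x y (T + 1)‖ →
        (T : ℝ) ≤ (Real.logb 2 (2 * LH ν Hf H / (2 * LH ν Hf H - muH ν Hf H)))⁻¹ *
          max 1 (KxH f ν Hf H x R₀ + (3 + ν) * Real.logb 2 ε⁻¹) ∧
        (ε ≤ 1 / 2 → 0 ≤ KxH f ν Hf H x R₀ →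
          (T : ℝ) ≤ (Real.logb 2 (2 * LH ν Hf H / (2 * LH ν Hf H - muH ν Hf H)))⁻¹ *
            (KxH f ν Hf H x R₀ + (3 + ν)) * Real.logb 2 ε⁻¹)) := by
  have hdom : (effDom φ).Nonempty := hφ_dom.mono intrinsicInterior_subset
  refine ⟨fun k hk => ?_, fun hpos ε T hε hT => ?_⟩
  · obtain ⟨k, rfl⟩ := Nat.exists_eq_add_of_le' hk
    exact hy.gPhi_mem_subdiff hν.1 hf_diff hφ hdom k
  have hxd := mem_effDom_of_bounded_sublevel hdom hx hsub
  have hmain := iteration_bound hν hHf hf_diff hf_conv hf_holder hφ hxd hx hR₀ hsub hH hy hpos hε hT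
  have hlog : 0 < Real.logb 2 (2 * LH ν Hf H / (2 * LH ν Hf H - muH ν Hf H)) := by
    have hL := one_le_LH hν.1 hHf hH
    have hμ := muH_pos hν.1 hHf hH hpos
    have hμ1 := muH_lt_one hν.1 hHf hH
    refine Real.logb_pos one_lt_two ?_
    rw [lt_div_iff₀ (by linarith)]
    linarith
  refine ⟨?_, fun hε2 hK => ?_⟩
  · rw [inv_mul_eq_div, le_div_iff₀ hlog]
    exact hmain
  · rw [mul_assoc, inv_mul_eq_div, le_div_iff₀ hlog]
    refine hmain.trans ?_
    -- Since `ε ≤ 1/2`, multiplying by this logarithm can only increase `K_{x,H}`, and it makes `3 +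
    -- ν` absorb the `1` of the maximum.
    have hl : 1 ≤ Real.logb 2 ε⁻¹ := by
      rw [Real.le_logb_iff_rpow_le one_lt_two (inv_pos.2 hε.1), Real.rpow_one,
        le_inv_comm₀ two_pos hε.1]
      linarith
    have h1 := mul_le_mul_of_nonneg_left hl hK
    have h2 := mul_le_mul_of_nonneg_left hl (by linarith [hν.1] : 0 ≤ 3 + ν)
    exact max_le (by linarith [hν.1]) (by linarith)
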